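/- **Theorem.** Let $\lambda$ be Lebesgue measure on $\mathbb{R}$. A *finite rectangle* in $\mathbb{R}^{\mathbb{N}}$ is a product $R=\prod_{i\in\mathbb{N}}C_i$ of Borel sets $C_i\subset\mathbb{R}$ with $\lambda(C_i)<\infty$ for all $i$, such that $\mathrm{vol}(R):=\prod_{i\in\mathbb{N}}\lambda(C_i)=\lim_{n\to\infty}\prod_{i\le n}\lambda(C_i)$ exists in $[0,\infty)$. Let $\mu$ be the Borel measure on $\mathbb{R}^{\mathbb{N}}$ (with the product topology) obtained by restricting to the Borel sets the outer measure $$\mu^*(A)=\inf\Big\{\sum_{n\in\mathbb{N}}\mathrm{vol}(R_n)\;:\; R_n \text{ finite rectangles},\ A\subset\bigcup_{n\in\mathbb{N}}R_n\Big\},\qquad \inf\varnothing=\infty .$$ For $\mathfrak a=(a_n)\in\mathbb{Z}^{\mathbb{N}}$ let $\mathcal{C}_{\mathfrak a}=\prod_{n\in\mathbb{N}}[a_n,a_n+1)$. Let $1\le p<\infty$ and let $L^p(\mu)$ be the real $L^p$-space of $\mu$. For $f\in L^p(\mu)$ put $\mathcal{O}_f=\{\mathfrak a\in\mathbb{Z}^{\mathbb{N}}:\int_{\mathcal{C}_{\mathfrak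 a}}|f|^p\,d\mu\ne0\}$ and $\mathcal{F}_f=\bigcup_{\mathfrak a\in\mathcal{O}_f}\mathcal{C}_{\mathfrak a}$, and define $$G^p=\Big\{f\in L^p(\mu):\int_{\mathbb{R}^{\mathbb{N}}}|f|^p\,d\mu=\sum_{\mathfrak a\in\mathcal{O}_f}\int_{\mathcal{C}_{\mathfrak a}}|f|^p\,d\mu=\int_{\mathcal{F}_f}|f|^p\,d\mu\Big\},$$ $$B^p=\Big\{f\in L^p(\mu):\int_{\mathcal{C}_{\mathfrak a}}|f|^p\,d\mu=0\ \text{ for every }\mathfrak a\in\mathbb{Z}^{\mathbb{N}}\Big\}.$$ Then $G^p$ and $B^p$ are closed linear subspaces of $L^p(\mu)$ which are topological complements of each other, so that $$L^p(\mu)=G^p\oplus B^p ,$$ and this is an $\ell^p$-direct sum: $(g,b)\mapsto g+b$ is an isometric isomorphism from $G^p\oplus B^p$, with the norm $(\|g\|^p+\|b\|^p)^{1/p}$, onto $L^p(\mu)$. Moreover, with $\mathfrak c$ the cardinality of the continuum, there is an isometric isomorphism $$L^p(\mu)\cong \ell^p(\mathfrak c,L^p[0,1])\oplus B^p ,$$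 where the right-hand side carries the $\ell^p$-direct sum norm and, for an index set $J$ of cardinality $\mathfrak c$, $\ell^p(\mathfrak c,L^p[0,1])$ is the space of families $(x_j)_{j\in J}$ in $L^p[0,1]$ with norm $(\sum_{j\in J}\|x_j\|^p)^{1/p}<\infty$. -/

import Mathlib

open MeasureTheory Filter Topology
open scoped ENNReal NNReal Cardinal

noncomputable section

/-- A finite rectangle `∏ᵢ Cᵢ` in `ℝ^ℕ`: the sides `Cᵢ` are Borel sets of finite Lebesgue measure
and the infinite product `∏ᵢ λ(Cᵢ)`, i.e. the limit of the partial products, exists and is a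
finite number `vol ∈ [0, ∞)`. -/
structure FiniteRectangle where
  side : ℕ → Set ℝ
  measurableSet_side : ∀ i, MeasurableSet (side i)
  volume_side_lt_top : ∀ i, volume (side i) < ∞
  vol : ℝ≥0
  tendsto_vol : Tendsto (fun n : ℕ => ∏ i ∈ Finset.range n, volume (side i)) atTop
    (𝓝 (vol : ℝ≥0∞))

namespace FiniteRectangle

/-- The subset of `ℝ^ℕ` underlying a finite rectangle. -/
def toSet (R : FiniteRectangle) : Set (ℕ → ℝ) := Set.univ.pi R.side

/-- The empty rectangle. -/
def empty : FiniteRectangle where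
  side _ := ∅
  measurableSet_side _ := MeasurableSet.empty
  volume_side_lt_top _ := by simp
  vol := 0
  tendsto_vol := by
    refine tendsto_const_nhds.congr' ?_
    filter_upwards [eventually_ge_atTop 1] with n hn
    simp [Finset.prod_const, zero_pow (show n ≠ 0 by omega)]

theorem toSet_empty : empty.toSet = ∅ :=
  Set.univ_pi_eq_empty (i := 0) rfl

/-- A rectangle splits along a coordinate into two rectangles whose volumes add up. -/
theorem exists_split (R : FiniteRectangle) (k : ℕ) {D : Set ℝ} (hD : MeasurableSet D) :
    ∃ R₁ R₂ : FiniteRectangle, R₁.toSet = R.toSet ∩ (fun x => x k) ⁻¹' D ∧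
      R₂.toSet = R.toSet \ (fun x => x k) ⁻¹' D ∧ R₁.vol + R₂.vol = R.vol := by
  classical
  -- replacing one side by a measurable subset of it gives a rectangle
  have key : ∀ E : Set ℝ, MeasurableSet E → E ⊆ R.side k → ∃ v : ℝ≥0,
      Tendsto (fun n : ℕ => ∏ i ∈ Finset.range n, volume (Function.update R.side k E i)) atTop
        (𝓝 (v : ℝ≥0∞)) := by
    intro E hE hER
    have hlt : volume E < ∞ := (measure_mono hER).trans_lt (R.volume_side_lt_top k)
    by_cases h0 : volume (R.side k) = 0
    · have hE0 : volume E = 0 := measure_mono_null hER h0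
      refine ⟨0, tendsto_const_nhds.congr' ?_⟩
      filter_upwards [eventually_gt_atTop k] with n hn
      rw [Finset.prod_eq_zero (Finset.mem_range.2 hn) (by simpa using hE0)]
      simp
    · have hc : volume E / volume (R.side k) ≠ ∞ := ENNReal.div_ne_top hlt.ne h0
      refine ⟨(volume E / volume (R.side k)).toNNReal * R.vol, ?_⟩
      have ht := ENNReal.Tendsto.const_mul (a := volume E / volume (R.side k)) R.tendsto_vol
        (Or.inr hc)
      rw [ENNReal.coe_mul, ENNReal.coe_toNNReal hc]
      refine ht.congr' ?_
      filter_upwards [eventually_gt_atTop k] with n hn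
      have hk : k ∈ Finset.range n := Finset.mem_range.2 hn
      rw [← Finset.mul_prod_erase _ _ hk, ← Finset.mul_prod_erase _ _ hk, ← mul_assoc,
        ENNReal.div_mul_cancel h0 (R.volume_side_lt_top k).ne, Function.update_self]
      congr 1
      refine Finset.prod_congr rfl fun i hi => ?_
      rw [Function.update_of_ne (Finset.ne_of_mem_erase hi)]
  have build : ∀ E : Set ℝ, MeasurableSet E → E ⊆ R.side k → ∃ R' : FiniteRectangle,
      R'.side = Function.update R.side k E := by
    intro E hE hER
    obtain ⟨v, hv⟩ := key E hE hER
    refine ⟨⟨Function.update R.side k E, fun i => ?_, fun i => ?_, v, hv⟩, rfl⟩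
    · rcases eq_or_ne i k with rfl | h
      · simpa using hE
      · simpa [h] using R.measurableSet_side i
    · rcases eq_or_ne i k with rfl | h
      · simpa using (measure_mono hER).trans_lt (R.volume_side_lt_top i)
      · simpa [h] using R.volume_side_lt_top i
  obtain ⟨R₁, h₁⟩ := build (R.side k ∩ D) ((R.measurableSet_side k).inter hD)
    Set.inter_subset_left
  obtain ⟨R₂, h₂⟩ := build (R.side k \ D) ((R.measurableSet_side k).diff hD) Set.sdiff_subset
  refine ⟨R₁, R₂, ?_, ?_, ?_⟩
  · ext x
    simp only [toSet, h₁, Set.mem_pi, Set.mem_univ, true_imp_iff, Set.mem_inter_iff,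
      Set.mem_preimage]
    constructor
    · intro h
      have hk : x k ∈ R.side k ∩ D := by simpa using h k
      refine ⟨fun i => ?_, hk.2⟩
      rcases eq_or_ne i k with rfl | hi
      · exact hk.1
      · simpa [hi] using h i
    · rintro ⟨h, hk⟩ i
      rcases eq_or_ne i k with rfl | hi
      · simpa using ⟨h i, hk⟩
      · simpa [hi] using h i
  · ext x
    simp only [toSet, h₂, Set.mem_pi, Set.mem_univ, true_imp_iff, Set.mem_sdiff,
      Set.mem_preimage]
    constructor
    · intro h
      have hk : x k ∈ R.side k \ D := by simpa using h k
      refine ⟨fun i => ?_, hk.2⟩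
      rcases eq_or_ne i k with rfl | hi
      · exact hk.1
      · simpa [hi] using h i
    · rintro ⟨h, hk⟩ i
      rcases eq_or_ne i k with rfl | hi
      · simpa using ⟨h i, hk⟩
      · simpa [hi] using h i
  · have hsum := R₁.tendsto_vol.add R₂.tendsto_vol
    have heq : (R₁.vol : ℝ≥0∞) + R₂.vol = R.vol := by
      refine tendsto_nhds_unique (hsum.congr' ?_) R.tendsto_vol
      filter_upwards [eventually_gt_atTop k] with n hn
      have hk : k ∈ Finset.range n := Finset.mem_range.2 hn
      rw [← Finset.mul_prod_erase _ _ hk, ← Finset.mul_prod_erase _ _ hk,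
        ← Finset.mul_prod_erase _ _ hk, h₁, h₂, Function.update_self, Function.update_self]
      have e : ∀ E : Set ℝ, ∏ i ∈ (Finset.range n).erase k, volume (Function.update R.side k E i)
          = ∏ i ∈ (Finset.range n).erase k, volume (R.side i) := fun E =>
        Finset.prod_congr rfl fun i hi => by
          rw [Function.update_of_ne (Finset.ne_of_mem_erase hi)]
      rw [e, e, ← add_mul, measure_inter_add_sdiff _ hD]
    exact_mod_cast heq

end FiniteRectangle

/-- The volume of `A` if `A` is a finite rectangle, and `∞` for all other sets `A ⊆ ℝ^ℕ`. -/
def rectangleVolume (A : Set (ℕ → ℝ)) : ℝ≥0∞ :=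
  ⨅ (R : FiniteRectangle) (_ : R.toSet = A), (R.vol : ℝ≥0∞)

theorem rectangleVolume_empty : rectangleVolume ∅ = 0 := by
  refine le_antisymm (iInf₂_le_of_le FiniteRectangle.empty FiniteRectangle.toSet_empty ?_) bot_le
  simp [FiniteRectangle.empty]

/-- The outer measure on `ℝ^ℕ` generated by countable covers by finite rectangles; the explicit
formula is `lebesgueOuter_apply`. -/
def lebesgueOuter : OuterMeasure (ℕ → ℝ) :=
  OuterMeasure.ofFunction rectangleVolume rectangleVolume_empty

/-- `lebesgueOuter A` is the infimum of `∑ₙ vol(Rₙ)` over all sequences of finite rectangles that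
cover `A` (and `∞` if there is no such sequence). -/
theorem lebesgueOuter_apply (A : Set (ℕ → ℝ)) :
    lebesgueOuter A =
      ⨅ (R : ℕ → FiniteRectangle) (_ : A ⊆ ⋃ n, (R n).toSet), ∑' n, ((R n).vol : ℝ≥0∞) := by
  have unique : ∀ R : FiniteRectangle, rectangleVolume R.toSet ≤ R.vol := fun R =>
    iInf₂_le_of_le R rfl le_rfl
  refine le_antisymm (le_iInf₂ fun R hR => ?_) ?_
  · exact (iInf₂_le_of_le (fun n => (R n).toSet) hR le_rfl).trans
      (ENNReal.tsum_le_tsum fun n => unique (R n))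
  · refine le_iInf₂ fun t ht => ?_
    refine ENNReal.le_of_forall_pos_le_add fun ε hε hfin => ?_
    obtain ⟨δ, hδ, hδε⟩ := ENNReal.exists_pos_sum_of_countable (ENNReal.coe_pos.2 hε).ne' ℕ
    have hex : ∀ n, ∃ R : FiniteRectangle, R.toSet = t n ∧
        (R.vol : ℝ≥0∞) < rectangleVolume (t n) + δ n := by
      intro n
      have hlt : rectangleVolume (t n) < rectangleVolume (t n) + δ n :=
        ENNReal.lt_add_right (ENNReal.ne_top_of_tsum_ne_top hfin.ne n)
          (ENNReal.coe_pos.2 (hδ n)).ne'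
      conv_lhs at hlt => rw [rectangleVolume]
      obtain ⟨R, hR⟩ := iInf_lt_iff.1 hlt
      obtain ⟨h, hR'⟩ := iInf_lt_iff.1 hR
      exact ⟨R, h, hR'⟩
    choose R hR hlt using hex
    refine iInf₂_le_of_le R (by simpa only [hR] using ht) ?_
    calc ∑' n, ((R n).vol : ℝ≥0∞) ≤ ∑' n, (rectangleVolume (t n) + δ n) :=
          ENNReal.tsum_le_tsum fun n => (hlt n).le
      _ = ∑' n, rectangleVolume (t n) + ∑' n, (δ n : ℝ≥0∞) := ENNReal.tsum_add
      _ ≤ _ := by gcongr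

/-- Borel subsets of `ℝ^ℕ` are Carathéodory measurable for `lebesgueOuter`. -/
theorem measurableSpace_le_caratheodory :
    (MeasurableSpace.pi : MeasurableSpace (ℕ → ℝ)) ≤ lebesgueOuter.caratheodory := by
  refine iSup_le fun k => ?_
  rintro _ ⟨D, hD, rfl⟩
  refine OuterMeasure.ofFunction_caratheodory fun t => le_iInf₂ fun R hR => ?_
  obtain ⟨R₁, R₂, h₁, h₂, hv⟩ := R.exists_split k hD
  rw [← hv, ENNReal.coe_add, ← hR]
  exact add_le_add (iInf₂_le_of_le R₁ h₁ le_rfl) (iInf₂_le_of_le R₂ h₂ le_rfl)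

/-- The infinite-dimensional Lebesgue measure: the restriction of `lebesgueOuter` to the
product (= Borel) `σ`-algebra of `ℝ^ℕ`. -/
def lebesgueInf : Measure (ℕ → ℝ) :=
  lebesgueOuter.toMeasure measurableSpace_le_caratheodory

theorem lebesgueInf_apply {A : Set (ℕ → ℝ)} (hA : MeasurableSet A) :
    lebesgueInf A = lebesgueOuter A :=
  toMeasure_apply _ _ hA

/-- The unit cube `∏ₙ [aₙ, aₙ + 1)`. -/
def unitCube (a : ℕ → ℤ) : Set (ℕ → ℝ) :=
  Set.univ.pi fun n => Set.Ico (a n : ℝ) (a n + 1)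

section

variable {p : ℝ≥0∞}

/-- The integral of `|f|^p` over `S`. -/
def powIntegral (f : Lp ℝ p lebesgueInf) (S : Set (ℕ → ℝ)) : ℝ≥0∞ :=
  ∫⁻ x in S, ‖f x‖ₑ ^ p.toReal ∂lebesgueInf

/-- The set of the `a` for which the integral of `|f|^p` over the cube of `a` is nonzero. -/
def activeIndices (f : Lp ℝ p lebesgueInf) : Set (ℕ → ℤ) :=
  {a | powIntegral f (unitCube a) ≠ 0}

/-- The union of the cubes on which the integral of `|f|^p` is nonzero. -/
def activeCubes (f : Lp ℝ p lebesgueInf) : Set (ℕ → ℝ) :=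
  ⋃ a ∈ activeIndices f, unitCube a

end

/-- The functions in `L^p` whose `p`-th power integral is carried by the unit cubes. -/
def goodSet (p : ℝ≥0∞) : Set (Lp ℝ p lebesgueInf) :=
  {f | powIntegral f Set.univ = ∑' a : activeIndices f, powIntegral f (unitCube a) ∧
    ∑' a : activeIndices f, powIntegral f (unitCube a) = powIntegral f (activeCubes f)}

/-- The functions in `L^p` whose `p`-th power integral vanishes on every unit cube. -/
def badSet (p : ℝ≥0∞) : Set (Lp ℝ p lebesgueInf) :=
  {f | ∀ a : ℕ → ℤ, powIntegral f (unitCube a) = 0}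

/-- The space `L^p[0,1]`. -/
abbrev LpUnitInterval (p : ℝ≥0∞) := Lp ℝ p (volume.restrict (Set.Icc (0 : ℝ) 1))

end

/-!
The unit cubes `unitCube a`, `a : ℕ → ℤ`, form a measurable partition of `ℝ^ℕ` into continuum many
sets, and the theorem is a statement about such a partition together with the identification of
`L^p` of a single cube.

*The partition.* For `f ∈ L^p(μ)` the measure `|f|^p μ` (`Lp.powMeasure`) is finite, so it charges
only countably many cubes. Cutting `f` at the union of these cubes, which is measurable, writes
`f = g + b` with `g` carried by countably many cubes (`Lp.carriedBy`) and `b` null on each cube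
(`Lp.nullOn`). A function of the first kind and one of the second vanish almost everywhere on
complementary sets, so `‖g + b‖^p = ‖g‖^p + ‖b‖^p`. This makes the sum map an isometric isomorphism
from the `ℓ^p`-direct sum (`Lp.exists_withLp_prod_linearIsometryEquiv`), and the continuity of the
projections, hence the closedness of both summands, follows from it
(`Lp.isTopCompl_of_withLp_prod`). The two submodules are `goodSet` and `badSet`
(`coe_carriedBy_unitCube`, `coe_nullOn_unitCube`).

*The good part as an `ℓ^p`-sum.* Restricting `g` to all cubes gives, by countable additivity of
`|g|^p μ`, an isometry into the `ℓ^p`-sum of the `L^p` spaces of the cubes. Its range is closed, as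
the space of good functions is complete, and contains the families with one nonzero entry, so the
isometry is onto (`Lp.nonempty_carriedBy_linearIsometryEquiv_lp`).

*One cube.* Each cube has measure one: it is a rectangle of volume one, and conversely the product
of the uniform distributions on its sides gives every rectangle at most its volume
(`lebesgueInf_unitCube`). Points are rectangles of volume zero, so `μ` restricted to a cube is an
atomless Borel probability measure on a Polish space. After embedding the space in `ℝ`, the
distribution function `F` of the measure is continuous, so it has a section `Q` on `(0, 1)`, which
maps the uniform distribution to the measure. Composition with `Q` is then an isometry of `L^p`
onto `L^p[0,1]`, with right inverse the composition with `F`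
(`nonempty_lp_linearIsometryEquiv_unitInterval`).
-/

/-! ### Atomless probability measures and `L^p[0,1]` -/

open ProbabilityTheory in
/-- The distribution function of an atomless probability measure on `ℝ` is continuous. -/
theorem continuous_cdf_of_noAtoms (ν : Measure ℝ) [IsProbabilityMeasure ν]
    (hν : ∀ x, ν {x} = 0) : Continuous (cdf ν) := by
  refine continuous_iff_continuousAt.2 fun x => ?_
  rw [(monotone_cdf ν).continuousAt_iff_leftLim_eq_rightLim, (cdf ν).rightLim_eq]
  refine le_antisymm ((monotone_cdf ν).leftLim_le le_rfl) ?_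
  have h := hν x
  rw [← measure_cdf ν, StieltjesFunction.measure_singleton, ENNReal.ofReal_eq_zero] at h
  linarith

/-- The quantile transform: an atomless probability measure on `ℝ` is the image of the uniform
distribution under an a.e. section of its distribution function. -/
theorem exists_cdf_section (ν : Measure ℝ) [IsProbabilityMeasure ν] (hν : ∀ x, ν {x} = 0) :
    ∃ Q : ℝ → ℝ, MeasurePreserving Q (volume.restrict (Set.Icc (0 : ℝ) 1)) ν ∧
      ∀ᵐ u ∂volume.restrict (Set.Icc (0 : ℝ) 1), ProbabilityTheory.cdf ν (Q u) = u := by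
  set F := ProbabilityTheory.cdf ν with hF
  have hmono : Monotone F := ProbabilityTheory.monotone_cdf ν
  have hcont : Continuous F := continuous_cdf_of_noAtoms ν hν
  have hsurj : ∀ u ∈ Set.Ioo (0 : ℝ) 1, ∃ x, F x = u := by
    intro u hu
    refine mem_range_of_exists_le_of_exists_ge hcont ?_ ?_
    · exact ((ProbabilityTheory.tendsto_cdf_atBot ν).eventually_le_const hu.1).exists
    · exact ((ProbabilityTheory.tendsto_cdf_atTop ν).eventually_const_le hu.2).exists
  -- `Q₀` is monotone only on `(0, 1)`, so it is replaced below by a measurable modification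
  choose! Q₀ hQ₀ using hsurj
  have hres : volume.restrict (Set.Icc (0 : ℝ) 1) = volume.restrict (Set.Ioo (0 : ℝ) 1) :=
    Measure.restrict_congr_set Ioo_ae_eq_Icc.symm
  have : IsProbabilityMeasure (volume.restrict (Set.Icc (0 : ℝ) 1)) :=
    ⟨by simp⟩
  have hQ₀m : AEMeasurable Q₀ (volume.restrict (Set.Icc (0 : ℝ) 1)) := by
    rw [hres]
    refine aemeasurable_restrict_of_monotoneOn measurableSet_Ioo fun u hu v hv huv => ?_
    by_contra! hlt
    have := hmono hlt.le
    rw [hQ₀ u hu, hQ₀ v hv] at this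
    obtain rfl := le_antisymm huv this
    exact lt_irrefl _ hlt
  have hsec : ∀ᵐ u ∂volume.restrict (Set.Icc (0 : ℝ) 1), F (hQ₀m.mk Q₀ u) = u := by
    have h1 : ∀ᵐ u ∂volume.restrict (Set.Icc (0 : ℝ) 1), F (Q₀ u) = u := by
      rw [hres]
      exact (ae_restrict_iff' measurableSet_Ioo).2 (ae_of_all _ hQ₀)
    filter_upwards [h1, hQ₀m.ae_eq_mk] with u h1 h2
    rw [← h2, h1]
  refine ⟨hQ₀m.mk Q₀, ⟨hQ₀m.measurable_mk, ?_⟩, hsec⟩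
  refine Measure.ext_of_Iic _ _ fun x => ?_
  rw [Measure.map_apply hQ₀m.measurable_mk measurableSet_Iic]
  have hx1 : F x ≤ 1 := ProbabilityTheory.cdf_le_one ν x
  -- up to the null event `u = F x`, the condition `Q u ≤ x` means `u ≤ F x`
  have hne : ∀ᵐ u ∂volume.restrict (Set.Icc (0 : ℝ) 1), u ≠ F x :=
    ae_restrict_of_ae (Measure.ae_ne volume (F x))
  have hset : (hQ₀m.mk Q₀ ⁻¹' Set.Iic x : Set ℝ) =ᵐ[volume.restrict (Set.Icc (0 : ℝ) 1)]
      Set.Iic (F x) := by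
    filter_upwards [hsec, hne] with u hu hux
    refine propext ⟨fun h => ?_, fun h => ?_⟩
    · change u ≤ F x
      rw [← hu]
      exact hmono h
    · change hQ₀m.mk Q₀ u ≤ x
      by_contra! hlt
      have := hmono hlt.le
      rw [hu] at this
      exact hux (le_antisymm h this)
  rw [measure_congr hset, Measure.restrict_apply measurableSet_Iic, Set.inter_comm,
    ← ProbabilityTheory.ofReal_cdf ν x, ← Set.Ici_inter_Iic, Set.inter_assoc, Set.Iic_inter_Iic,
    min_eq_right hx1, Set.Ici_inter_Iic, Real.volume_Icc, sub_zero]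

/-- A measurable map with a measure-preserving a.e. section is itself measure-preserving, and
composition with the section is an isometric isomorphism between the `L^p` spaces: it is onto
because composition with the map is a right inverse. -/
theorem nonempty_lp_linearIsometryEquiv_of_section {α β : Type*} [MeasurableSpace α]
    [MeasurableSpace β] {μ : Measure α} {ν : Measure β} (p : ℝ≥0∞) [Fact (1 ≤ p)]
    {f : α → β} {g : β → α} (hfm : Measurable f) (hg : MeasurePreserving g ν μ)
    (hfg : ∀ᵐ y ∂ν, f (g y) = y) : Nonempty (Lp ℝ p μ ≃ₗᵢ[ℝ] Lp ℝ p ν) := by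
  have hf : MeasurePreserving f μ ν := by
    refine ⟨hfm, ?_⟩
    rw [← hg.map_eq, Measure.map_map hfm hg.measurable]
    exact (Measure.map_congr hfg).trans Measure.map_id
  refine ⟨.ofSurjective (Lp.compMeasurePreservingₗᵢ ℝ g hg) fun h =>
    ⟨Lp.compMeasurePreservingₗᵢ ℝ f hf h, ?_⟩⟩
  refine Lp.ext ?_
  have h1 : Lp.compMeasurePreserving g hg (Lp.compMeasurePreserving f hf h) =ᵐ[ν] _ :=
    Lp.coeFn_compMeasurePreserving _ hg
  have h2 := hg.quasiMeasurePreserving.ae (Lp.coeFn_compMeasurePreserving h hf)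
  filter_upwards [h1, h2, hfg] with y h1 h2 h3
  exact h1.trans (h2.trans (congrArg h h3))

/-- `L^p` of an atomless probability measure on a standard Borel space is isometrically
isomorphic to `L^p[0,1]`. -/
theorem nonempty_lp_linearIsometryEquiv_unitInterval {α : Type*} [MeasurableSpace α]
    [StandardBorelSpace α] (ν : Measure α) [IsProbabilityMeasure ν]
    (hν : ∀ x, ν {x} = 0) (p : ℝ≥0∞) [Fact (1 ≤ p)] :
    Nonempty (Lp ℝ p ν ≃ₗᵢ[ℝ] LpUnitInterval p) := by
  have : Nonempty α := nonempty_of_isProbabilityMeasure ν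
  set e := embeddingReal α
  have he : MeasurableEmbedding e := measurableEmbedding_embeddingReal α
  have : IsProbabilityMeasure (ν.map e) :=
    Measure.isProbabilityMeasure_map he.measurable.aemeasurable
  have hatom : ∀ x, ν.map e {x} = 0 := by
    intro x
    rw [Measure.map_apply he.measurable (measurableSet_singleton x)]
    rcases (Set.subsingleton_singleton.preimage he.injective).eq_empty_or_singleton with
      h | ⟨y, h⟩
    · rw [h, measure_empty]
    · rw [h, hν y]
  obtain ⟨Q, hQ, hsec⟩ := exists_cdf_section (ν.map e) hatom
  have hinv : MeasurePreserving he.invFun (ν.map e) ν := by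
    refine ⟨he.measurable_invFun, ?_⟩
    rw [Measure.map_map he.measurable_invFun he.measurable, he.leftInverse_invFun.comp_eq_id,
      Measure.map_id]
  have hrange : ∀ᵐ y ∂ν.map e, e (he.invFun y) = y :=
    he.ae_map_iff.2 (ae_of_all _ fun x => congrArg e (he.leftInverse_invFun x))
  have hg : MeasurePreserving (he.invFun ∘ Q) (volume.restrict (Set.Icc (0 : ℝ) 1)) ν :=
    hinv.comp hQ
  have hfg : ∀ᵐ u ∂volume.restrict (Set.Icc (0 : ℝ) 1),
      (ProbabilityTheory.cdf (ν.map e) ∘ e) ((he.invFun ∘ Q) u) = u := by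
    filter_upwards [hsec, hQ.quasiMeasurePreserving.ae hrange] with u h1 h2
    simp only [Function.comp_apply, h2, h1]
  have hfm : Measurable (ProbabilityTheory.cdf (ν.map e) ∘ e) :=
    (ProbabilityTheory.monotone_cdf _).measurable.comp he.measurable
  exact nonempty_lp_linearIsometryEquiv_of_section p hfm hg hfg

/-! ### The measure of the unit cubes -/

theorem measurableSet_unitCube (a : ℕ → ℤ) : MeasurableSet (unitCube a) :=
  MeasurableSet.univ_pi fun _ => measurableSet_Ico

theorem pairwise_disjoint_unitCube : Pairwise (Function.onFun Disjoint unitCube) := by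
  intro a b hab
  refine Set.disjoint_left.2 fun x ha hb => hab (funext fun n => ?_)
  rw [← Int.floor_eq_iff.2 (ha n (Set.mem_univ n)), Int.floor_eq_iff.2 (hb n (Set.mem_univ n))]

theorem lebesgueOuter_toSet_le (R : FiniteRectangle) : lebesgueOuter R.toSet ≤ R.vol :=
  (OuterMeasure.ofFunction_le _).trans (iInf₂_le_of_le R rfl le_rfl)

/-- A singleton is a finite rectangle of volume zero. -/
theorem lebesgueInf_singleton (x : ℕ → ℝ) : lebesgueInf {x} = 0 := by
  let R : FiniteRectangle :=
    { side := fun i => {x i}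
      measurableSet_side := fun i => measurableSet_singleton _
      volume_side_lt_top := fun i => by simp
      vol := 0
      tendsto_vol := by
        refine tendsto_const_nhds.congr' ?_
        filter_upwards [eventually_ge_atTop 1] with n hn
        simp [Finset.prod_const, zero_pow (show n ≠ 0 by omega)] }
  have hR : R.toSet = {x} := Set.univ_pi_singleton x
  rw [lebesgueInf_apply (measurableSet_singleton x), ← hR]
  exact le_antisymm (lebesgueOuter_toSet_le R) bot_le

/-- The lower bound comes from the product of the uniform distributions on the sides of the
cube, which gives to each finite rectangle a mass of at most its volume. -/
theorem lebesgueInf_unitCube (a : ℕ → ℤ) : lebesgueInf (unitCube a) = 1 := by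
  rw [lebesgueInf_apply (measurableSet_unitCube a)]
  refine le_antisymm ?_ ?_
  · let R : FiniteRectangle :=
      { side := fun n => Set.Ico (a n : ℝ) (a n + 1)
        measurableSet_side := fun _ => measurableSet_Ico
        volume_side_lt_top := fun _ => by simp
        vol := 1
        tendsto_vol := by simp }
    exact lebesgueOuter_toSet_le R
  · let ρ : ℕ → Measure ℝ := fun n => volume.restrict (Set.Ico (a n : ℝ) (a n + 1))
    have : ∀ n, IsProbabilityMeasure (ρ n) := fun n => ⟨by simp [ρ]⟩
    have hle : (Measure.infinitePi ρ).toOuterMeasure ≤ lebesgueOuter := by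
      refine OuterMeasure.le_ofFunction.2 fun s => le_iInf₂ fun R hR => ?_
      refine ge_of_tendsto' R.tendsto_vol fun n => ?_
      calc Measure.infinitePi ρ s
          ≤ Measure.infinitePi ρ (Set.pi (Finset.range n) R.side) := by
            rw [← hR]
            exact measure_mono fun x hx i _ => hx i (Set.mem_univ i)
        _ = ∏ i ∈ Finset.range n, ρ i (R.side i) :=
            Measure.infinitePi_pi ρ fun i _ => R.measurableSet_side i
        _ ≤ ∏ i ∈ Finset.range n, volume (R.side i) :=
            Finset.prod_le_prod' fun i _ => Measure.restrict_apply_le _ _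
    calc (1 : ℝ≥0∞) = Measure.infinitePi ρ (unitCube a) := by
          rw [unitCube, Measure.infinitePi_pi_univ ρ fun _ => measurableSet_Ico]
          simp [ρ]
      _ ≤ lebesgueOuter (unitCube a) := hle _

theorem nonempty_lp_unitCube_linearIsometryEquiv (p : ℝ≥0∞) [Fact (1 ≤ p)] (a : ℕ → ℤ) :
    Nonempty (Lp ℝ p (lebesgueInf.restrict (unitCube a)) ≃ₗᵢ[ℝ] LpUnitInterval p) := by
  have : IsProbabilityMeasure (lebesgueInf.restrict (unitCube a)) :=
    ⟨by rw [Measure.restrict_apply_univ, lebesgueInf_unitCube]⟩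
  exact nonempty_lp_linearIsometryEquiv_unitInterval _
    (fun x => Measure.restrict_le_self.absolutelyContinuous (lebesgueInf_singleton x)) p

/-! ### Restricting `L^p` functions to measurable sets -/

namespace MeasureTheory.Lp

variable {α : Type*} [MeasurableSpace α] {μ : Measure α} {p : ℝ≥0∞}

/-- The measure with density `|f|^p` with respect to `μ`. -/
noncomputable def powMeasure (f : Lp ℝ p μ) : Measure α :=
  μ.withDensity fun x => ‖f x‖ₑ ^ p.toReal

theorem powMeasure_apply (f : Lp ℝ p μ) {S : Set α} (hS : MeasurableSet S) :
    powMeasure f S = ∫⁻ x in S, ‖f x‖ₑ ^ p.toReal ∂μ :=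
  withDensity_apply _ hS

variable [Fact (1 ≤ p)]

/-- Restriction of `L^p` functions to the set `S`. -/
noncomputable abbrev restr (S : Set α) : Lp ℝ p μ →L[ℝ] Lp ℝ p (μ.restrict S) :=
  LpToLpRestrictCLM α ℝ ℝ μ p S

theorem toReal_exponent_pos (hp : p ≠ ∞) : 0 < p.toReal :=
  ENNReal.toReal_pos (zero_lt_one.trans_le Fact.out).ne' hp

theorem enorm_rpow_eq_lintegral (hp : p ≠ ∞) (f : Lp ℝ p μ) :
    ‖f‖ₑ ^ p.toReal = ∫⁻ x, ‖f x‖ₑ ^ p.toReal ∂μ := by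
  rw [enorm_def, eLpNorm_eq_lintegral_rpow_enorm_toReal (zero_lt_one.trans_le Fact.out).ne' hp,
    ← ENNReal.rpow_mul, one_div, inv_mul_cancel₀ (toReal_exponent_pos hp).ne', ENNReal.rpow_one]

theorem powMeasure_univ (hp : p ≠ ∞) (f : Lp ℝ p μ) :
    powMeasure f Set.univ = ‖f‖ₑ ^ p.toReal := by
  rw [powMeasure_apply f MeasurableSet.univ, Measure.restrict_univ, enorm_rpow_eq_lintegral hp]

theorem isFiniteMeasure_powMeasure (hp : p ≠ ∞) (f : Lp ℝ p μ) :
    IsFiniteMeasure (powMeasure f) :=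
  ⟨by
    rw [powMeasure_univ hp]
    exact ENNReal.rpow_lt_top_of_nonneg ENNReal.toReal_nonneg enorm_ne_top⟩

theorem enorm_restr_rpow (hp : p ≠ ∞) (f : Lp ℝ p μ) {S : Set α} (hS : MeasurableSet S) :
    ‖restr S f‖ₑ ^ p.toReal = powMeasure f S := by
  rw [enorm_rpow_eq_lintegral hp, powMeasure_apply f hS]
  refine lintegral_congr_ae ?_
  filter_upwards [LpToLpRestrictCLM_coeFn ℝ S f] with x hx
  rw [hx]

theorem norm_rpow_eq_real_powMeasure (hp : p ≠ ∞) (f : Lp ℝ p μ) :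
    ‖f‖ ^ p.toReal = (powMeasure f).real Set.univ := by
  rw [measureReal_def, powMeasure_univ hp, ← ENNReal.toReal_rpow, toReal_enorm]

theorem norm_restr_rpow (hp : p ≠ ∞) (f : Lp ℝ p μ) {S : Set α} (hS : MeasurableSet S) :
    ‖restr S f‖ ^ p.toReal = (powMeasure f).real S := by
  rw [measureReal_def, ← enorm_restr_rpow hp f hS, ← ENNReal.toReal_rpow, toReal_enorm]

theorem restr_eq_zero_iff (hp : p ≠ ∞) (f : Lp ℝ p μ) {S : Set α} (hS : MeasurableSet S) :
    restr S f = 0 ↔ powMeasure f S = 0 := by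
  rw [← enorm_restr_rpow hp f hS, ENNReal.rpow_eq_zero_iff_of_pos (toReal_exponent_pos hp),
    enorm_eq_zero]

/-- Additivity of `‖·‖^p` over a measurable set and its complement. -/
theorem norm_rpow_eq_restr_add_compl (hp : p ≠ ∞) (f : Lp ℝ p μ) {S : Set α}
    (hS : MeasurableSet S) :
    ‖f‖ ^ p.toReal = ‖restr S f‖ ^ p.toReal + ‖restr Sᶜ f‖ ^ p.toReal := by
  have := isFiniteMeasure_powMeasure hp f
  rw [norm_rpow_eq_real_powMeasure hp, norm_restr_rpow hp f hS, norm_restr_rpow hp f hS.compl,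
    measureReal_add_measureReal_compl hS]

/-- Two functions that vanish on complementary sets have disjoint supports, so the `p`-th powers
of their norms add up. -/
theorem norm_add_rpow_of_restr_eq_zero (hp : p ≠ ∞) {f g : Lp ℝ p μ} {S : Set α}
    (hS : MeasurableSet S) (hf : restr Sᶜ f = 0) (hg : restr S g = 0) :
    ‖f + g‖ ^ p.toReal = ‖f‖ ^ p.toReal + ‖g‖ ^ p.toReal := by
  rw [norm_rpow_eq_restr_add_compl hp (f + g) hS, norm_rpow_eq_restr_add_compl hp f hS,
    norm_rpow_eq_restr_add_compl hp g hS, map_add, map_add, hf, hg]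
  simp [Real.zero_rpow (toReal_exponent_pos hp).ne']

/-- Restriction to a measurable set is onto: extend by zero. -/
theorem exists_restr_eq_restr_compl_eq_zero {S : Set α} (hS : MeasurableSet S)
    (h : Lp ℝ p (μ.restrict S)) : ∃ f : Lp ℝ p μ, restr S f = h ∧ restr Sᶜ f = 0 := by
  have hmem : MemLp (S.indicator h) p μ := (memLp_indicator_iff_restrict hS).2 (Lp.memLp h)
  refine ⟨hmem.toLp, Lp.ext ?_, Lp.ext ?_⟩
  · filter_upwards [LpToLpRestrictCLM_coeFn ℝ S hmem.toLp,
      ae_restrict_of_ae hmem.coeFn_toLp, ae_restrict_mem hS] with x h1 h2 h3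
    rw [h1, h2, Set.indicator_of_mem h3]
  · filter_upwards [LpToLpRestrictCLM_coeFn ℝ Sᶜ hmem.toLp,
      ae_restrict_of_ae hmem.coeFn_toLp, ae_restrict_mem hS.compl,
      Lp.coeFn_zero ℝ p (μ.restrict Sᶜ)] with x h1 h2 h3 h4
    rw [h1, h2, Set.indicator_of_notMem h3, h4, Pi.zero_apply]

/-! ### Functions carried by countably many members of a disjoint family of sets -/

variable {κ : Type*} {C : κ → Set α}

theorem measurableSet_biUnion_of_countable (hC : ∀ a, MeasurableSet (C a)) {S : Set κ}
    (hS : S.Countable) : MeasurableSet (⋃ a ∈ S, C a) :=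
  MeasurableSet.biUnion hS fun a _ => hC a

/-- The `L^p` functions that vanish almost everywhere on each of the sets `C a`. -/
noncomputable def nullOn (μ : Measure α) (p : ℝ≥0∞) [Fact (1 ≤ p)] (C : κ → Set α) :
    Submodule ℝ (Lp ℝ p μ) :=
  ⨅ a, LinearMap.ker (restr (μ := μ) (p := p) (C a)).toLinearMap

theorem mem_nullOn {f : Lp ℝ p μ} : f ∈ nullOn μ p C ↔ ∀ a, restr (C a) f = 0 := by
  simp [nullOn]

theorem mem_nullOn_iff_powMeasure (hp : p ≠ ∞) (hC : ∀ a, MeasurableSet (C a)) {f : Lp ℝ p μ} :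
    f ∈ nullOn μ p C ↔ ∀ a, powMeasure f (C a) = 0 :=
  mem_nullOn.trans (forall_congr' fun a => restr_eq_zero_iff hp f (hC a))

/-- The `L^p` functions that vanish almost everywhere outside the union of countably many of the
sets `C a`. -/
noncomputable def carriedBy (μ : Measure α) (p : ℝ≥0∞) [Fact (1 ≤ p)] (hp : p ≠ ∞)
    (C : κ → Set α) (hC : ∀ a, MeasurableSet (C a)) : Submodule ℝ (Lp ℝ p μ) where
  carrier := {f | ∃ S : Set κ, S.Countable ∧ restr (⋃ a ∈ S, C a)ᶜ f = 0}
  zero_mem' := ⟨∅, Set.countable_empty, map_zero _⟩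
  smul_mem' := by
    rintro c f ⟨S, hS, hf⟩
    exact ⟨S, hS, by rw [map_smul, hf, smul_zero]⟩
  add_mem' := by
    rintro f g ⟨S, hS, hf⟩ ⟨T, hT, hg⟩
    have mono : ∀ {U : Set κ} {h : Lp ℝ p μ}, U.Countable → U ⊆ S ∪ T →
        restr (⋃ a ∈ U, C a)ᶜ h = 0 → restr (⋃ a ∈ S ∪ T, C a)ᶜ h = 0 := by
      intro U h hU hUST h0
      rw [restr_eq_zero_iff hp _ (measurableSet_biUnion_of_countable hC hU).compl] at h0
      rw [restr_eq_zero_iff hp _ (measurableSet_biUnion_of_countable hC (hS.union hT)).compl]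
      exact measure_mono_null
        (Set.compl_subset_compl.2 (Set.biUnion_subset_biUnion_left hUST)) h0
    refine ⟨S ∪ T, hS.union hT, ?_⟩
    rw [map_add, mono hS Set.subset_union_left hf, mono hT Set.subset_union_right hg, add_zero]

theorem mem_carriedBy {hp : p ≠ ∞} {hC : ∀ a, MeasurableSet (C a)} {f : Lp ℝ p μ} :
    f ∈ carriedBy μ p hp C hC ↔ ∃ S : Set κ, S.Countable ∧ restr (⋃ a ∈ S, C a)ᶜ f = 0 :=
  Iff.rfl

/-- A finite measure charges only countably many members of a disjoint family. -/
theorem countable_powMeasure_ne_zero (hp : p ≠ ∞) (hC : ∀ a, MeasurableSet (C a))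
    (hd : Pairwise (Function.onFun Disjoint C)) (f : Lp ℝ p μ) :
    {a | powMeasure f (C a) ≠ 0}.Countable := by
  have := isFiniteMeasure_powMeasure hp f
  refine Summable.countable_support_ennreal (f := fun a => powMeasure f (C a)) ?_
  exact ((tsum_meas_le_meas_iUnion_of_disjoint _ hC hd).trans_lt (measure_lt_top _ _)).ne

/-- For a function carried by countably many of the `C a`, the sum over the whole, possibly
uncountable, family recovers the total mass of `|f|^p`. -/
theorem tsum_powMeasure_of_mem_carriedBy {hp : p ≠ ∞} {hC : ∀ a, MeasurableSet (C a)}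
    (hd : Pairwise (Function.onFun Disjoint C)) {f : Lp ℝ p μ} (hf : f ∈ carriedBy μ p hp C hC) :
    ∑' a, powMeasure f (C a) = powMeasure f Set.univ := by
  obtain ⟨S, hS, h⟩ := hf
  rw [restr_eq_zero_iff hp _ (measurableSet_biUnion_of_countable hC hS).compl] at h
  refine le_antisymm ((tsum_meas_le_meas_iUnion_of_disjoint _ hC hd).trans
    (measure_mono (Set.subset_univ _))) ?_
  calc powMeasure f Set.univ
      ≤ powMeasure f (⋃ a ∈ S, C a) + powMeasure f (⋃ a ∈ S, C a)ᶜ := by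
        rw [← Set.union_compl_self (⋃ a ∈ S, C a)]
        exact measure_union_le _ _
    _ ≤ ∑' a : S, powMeasure f (C a) := by
        rw [h, add_zero]
        exact measure_biUnion_le _ hS _
    _ ≤ ∑' a, powMeasure f (C a) := ENNReal.tsum_comp_le_tsum_of_injective Subtype.val_injective _

/-- The first summand is `f` cut at the union of the countably many `C a` charged by `|f|^p`. -/
theorem exists_add_of_pairwise_disjoint {hp : p ≠ ∞} {hC : ∀ a, MeasurableSet (C a)}
    (hd : Pairwise (Function.onFun Disjoint C)) (f : Lp ℝ p μ) :
    ∃ g ∈ carriedBy μ p hp C hC, ∃ b ∈ nullOn μ p C, g + b = f := by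
  set S := {a | powMeasure f (C a) ≠ 0}
  have hS : S.Countable := countable_powMeasure_ne_zero hp hC hd f
  have hT := measurableSet_biUnion_of_countable hC hS
  obtain ⟨g, hg, hg0⟩ := exists_restr_eq_restr_compl_eq_zero hT (restr (⋃ a ∈ S, C a) f)
  refine ⟨g, ⟨S, hS, hg0⟩, f - g, ?_, add_sub_cancel _ _⟩
  rw [mem_nullOn_iff_powMeasure hp hC]
  intro a
  by_cases ha : a ∈ S
  · refine measure_mono_null (Set.subset_biUnion_of_mem ha) ?_
    rw [← restr_eq_zero_iff hp _ hT, map_sub, hg, sub_self]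
  · have hsub : C a ⊆ (⋃ b ∈ S, C b)ᶜ := by
      refine Set.disjoint_left.1 (Set.disjoint_iUnion₂_right.2 fun b hb => hd ?_)
      rintro rfl
      exact ha hb
    rw [← restr_eq_zero_iff hp _ (hC a), map_sub,
      (restr_eq_zero_iff hp f (hC a)).2 (not_not.1 ha),
      (restr_eq_zero_iff hp g (hC a)).2 (measure_mono_null hsub
        ((restr_eq_zero_iff hp g hT.compl).1 hg0)), sub_zero]

/-- The second function vanishes on the countable union that carries the first one. -/
theorem norm_add_rpow_of_mem {hp : p ≠ ∞} {hC : ∀ a, MeasurableSet (C a)} {g b : Lp ℝ p μ}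
    (hg : g ∈ carriedBy μ p hp C hC) (hb : b ∈ nullOn μ p C) :
    ‖g + b‖ ^ p.toReal = ‖g‖ ^ p.toReal + ‖b‖ ^ p.toReal := by
  obtain ⟨S, hS, hg⟩ := hg
  have hT := measurableSet_biUnion_of_countable hC hS
  refine norm_add_rpow_of_restr_eq_zero hp hT hg ?_
  rw [restr_eq_zero_iff hp _ hT, measure_biUnion_null_iff hS]
  exact fun a _ => (mem_nullOn_iff_powMeasure hp hC).1 hb a

/-- The `L^p` space of `μ` is the `ℓ^p`-direct sum of the functions carried by countably many
members of a disjoint family and the functions vanishing on each member. -/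
theorem exists_withLp_prod_linearIsometryEquiv (hp : p ≠ ∞) (hC : ∀ a, MeasurableSet (C a))
    (hd : Pairwise (Function.onFun Disjoint C)) :
    ∃ Φ : WithLp p (carriedBy μ p hp C hC × nullOn μ p C) ≃ₗᵢ[ℝ] Lp ℝ p μ,
      ∀ (g : carriedBy μ p hp C hC) (b : nullOn μ p C),
        Φ (WithLp.toLp p (g, b)) = (g : Lp ℝ p μ) + (b : Lp ℝ p μ) := by
  let L : WithLp p (carriedBy μ p hp C hC × nullOn μ p C) →ₗ[ℝ] Lp ℝ p μ :=
    ((carriedBy μ p hp C hC).subtype.coprod (nullOn μ p C).subtype).comp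
      (WithLp.linearEquiv p ℝ _).toLinearMap
  have hL : ∀ x, ‖L x‖ = ‖x‖ := by
    intro x
    have h : ‖L x‖ ^ p.toReal = ‖x.fst‖ ^ p.toReal + ‖x.snd‖ ^ p.toReal :=
      norm_add_rpow_of_mem x.fst.2 x.snd.2
    rw [WithLp.prod_norm_eq_add (toReal_exponent_pos hp), ← h, one_div,
      Real.rpow_rpow_inv (norm_nonneg _) (toReal_exponent_pos hp).ne']
  refine ⟨.ofSurjective ⟨L, hL⟩ fun f => ?_, fun g b => rfl⟩
  obtain ⟨g, hg, b, hb, h⟩ := exists_add_of_pairwise_disjoint (hp := hp) (hC := hC) hd f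
  exact ⟨WithLp.toLp p (⟨g, hg⟩, ⟨b, hb⟩), h⟩

/-- The projection onto the first summand is the first coordinate of the continuous inverse of the
sum map. -/
theorem isTopCompl_of_withLp_prod {E : Type*} [NormedAddCommGroup E] [NormedSpace ℝ E]
    {G B : Submodule ℝ E} (Φ : WithLp p (G × B) ≃ₗᵢ[ℝ] E)
    (hΦ : ∀ (g : G) (b : B), Φ (WithLp.toLp p (g, b)) = (g : E) + (b : E)) :
    Submodule.IsTopCompl G B := by
  have hsymm : ∀ (g : G) (b : B), Φ.symm ((g : E) + b) = WithLp.toLp p (g, b) := fun g b => by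
    rw [← hΦ, Φ.symm_apply_apply]
  let P : E →L[ℝ] G := (WithLp.fstL p ℝ G B).comp (Φ.symm : E →L[ℝ] WithLp p (G × B))
  have hP : ∀ (g : G) (b : B), P ((g : E) + b) = g := fun g b =>
    congrArg WithLp.fst (hsymm g b)
  have hker : P.ker = B := by
    ext x
    obtain ⟨⟨g, b⟩, rfl⟩ := Φ.surjective.comp (WithLp.toLp_surjective p) x
    rw [Function.comp_apply, hΦ, LinearMap.mem_ker]
    change P _ = 0 ↔ _
    rw [hP]
    constructor
    · rintro rfl
      simp
    · intro h
      have hg : (g : E) ∈ B := by simpa using B.sub_mem h b.2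
      have := (hsymm g 0).symm.trans (by simpa using hsymm 0 ⟨g, hg⟩)
      exact congrArg WithLp.fst this
  rw [← hker]
  exact ContinuousLinearMap.isTopCompl_of_proj fun g => by simpa using hP g 0

/-- If `L^p` of each `C a` is isometrically isomorphic to `E`, then the functions carried by
countably many of the `C a` form the `ℓ^p`-sum of copies of `E`. -/
theorem nonempty_carriedBy_linearIsometryEquiv_lp (hp : p ≠ ∞) (hC : ∀ a, MeasurableSet (C a))
    (hd : Pairwise (Function.onFun Disjoint C))
    (hcl : IsClosed (carriedBy μ p hp C hC : Set (Lp ℝ p μ)))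
    {E : Type*} [NormedAddCommGroup E] [NormedSpace ℝ E]
    (e : ∀ a, Lp ℝ p (μ.restrict (C a)) ≃ₗᵢ[ℝ] E) {ι : Type*} (σ : ι ≃ κ) :
    Nonempty (carriedBy μ p hp C hC ≃ₗᵢ[ℝ] lp (fun _ : ι => E) p) := by
  have hp0 := toReal_exponent_pos hp
  have hsum : ∀ g : carriedBy μ p hp C hC,
      HasSum (fun i => ‖e (σ i) (restr (C (σ i)) (g : Lp ℝ p μ))‖ ^ p.toReal)
        (‖g‖ ^ p.toReal) := by
    intro g
    have := isFiniteMeasure_powMeasure hp (g : Lp ℝ p μ)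
    have ht := tsum_powMeasure_of_mem_carriedBy hd g.2
    have hs := ENNReal.hasSum_toReal (ht.trans_ne (measure_ne_top _ _))
    rw [← ENNReal.tsum_toReal_eq fun a => measure_ne_top _ _, ht] at hs
    rw [Submodule.coe_norm, norm_rpow_eq_real_powMeasure hp]
    refine (σ.hasSum_iff.2 hs).congr_fun fun i => ?_
    rw [LinearIsometryEquiv.norm_map, norm_restr_rpow hp _ (hC _)]
    rfl
  let T : carriedBy μ p hp C hC →ₗᵢ[ℝ] lp (fun _ : ι => E) p :=
    { toFun := fun g => ⟨fun i => e (σ i) (restr (C (σ i)) (g : Lp ℝ p μ)),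
        memℓp_gen (hsum g).summable⟩
      map_add' := fun g h => by
        ext i
        exact (congrArg (e (σ i)) (map_add _ _ _)).trans (map_add _ _ _)
      map_smul' := fun c g => by
        ext i
        simp
      norm_map' := fun g => by
        refine (Real.rpow_left_inj (norm_nonneg _) (norm_nonneg _) hp0.ne').1 ?_
        exact (lp.hasSum_norm hp0 _).unique (hsum g) }
  have hT : ∀ g i, T g i = e (σ i) (restr (C (σ i)) (g : Lp ℝ p μ)) := fun _ _ => rfl
  classical
  have hsingle : ∀ i x, ∃ g, T g = lp.single p i x := by
    intro i x
    obtain ⟨f, hf, hf0⟩ := exists_restr_eq_restr_compl_eq_zero (hC (σ i)) ((e (σ i)).symm x)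
    refine ⟨⟨f, {σ i}, Set.countable_singleton _, ?_⟩, ?_⟩
    · rwa [Set.biUnion_singleton]
    · ext j
      rw [hT]
      rcases eq_or_ne j i with rfl | hj
      · rw [hf, lp.single_apply_self, LinearIsometryEquiv.apply_symm_apply]
      · rw [lp.single_apply_ne _ _ _ hj]
        have h0 : restr (C (σ j)) f = 0 := by
          rw [restr_eq_zero_iff hp _ (hC _)]
          refine measure_mono_null ?_ ((restr_eq_zero_iff hp f (hC _).compl).1 hf0)
          exact Set.disjoint_left.1 (hd (σ.injective.ne hj))
        rw [h0, map_zero]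
  -- the range of the isometry is closed and contains all finitely supported families
  have : CompleteSpace (carriedBy μ p hp C hC) := hcl.completeSpace_coe
  refine ⟨.ofSurjective T fun y => ?_⟩
  have hclosed : IsClosed (Set.range T) := T.isometry.isClosedEmbedding.isClosed_range
  refine hclosed.mem_of_tendsto (lp.hasSum_single hp y) (Eventually.of_forall fun s => ?_)
  choose! g hg using hsingle
  exact ⟨∑ i ∈ s, g i (y i), by simp [hg]⟩

end MeasureTheory.Lp

/-! ### The good and the bad functions -/

section

open MeasureTheory.Lp

variable {p : ℝ≥0∞} [Fact (1 ≤ p)]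

theorem coe_nullOn_unitCube (hp : p ≠ ∞) :
    (nullOn lebesgueInf p unitCube : Set (Lp ℝ p lebesgueInf)) = badSet p := by
  ext f
  rw [SetLike.mem_coe, mem_nullOn_iff_powMeasure hp measurableSet_unitCube]
  exact forall_congr' fun a => by rw [powMeasure_apply f (measurableSet_unitCube a)]; rfl

/-- The second defining equation of `goodSet` always holds, by countable additivity; the first one
says that `|f|^p` has no mass outside the countably many active cubes. -/
theorem coe_carriedBy_unitCube (hp : p ≠ ∞) :
    (carriedBy lebesgueInf p hp unitCube measurableSet_unitCube : Set (Lp ℝ p lebesgueInf)) =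
      goodSet p := by
  ext f
  have := isFiniteMeasure_powMeasure hp f
  have hpow : ∀ {S : Set (ℕ → ℝ)}, MeasurableSet S → powIntegral f S = powMeasure f S :=
    fun hS => (powMeasure_apply f hS).symm
  have hact : ∀ a, a ∈ activeIndices f ↔ powMeasure f (unitCube a) ≠ 0 := fun a =>
    not_congr (by rw [hpow (measurableSet_unitCube a)])
  have hcount : (activeIndices f).Countable :=
    (countable_powMeasure_ne_zero hp measurableSet_unitCube pairwise_disjoint_unitCube f).mono
      fun a => (hact a).1
  have hmeas : MeasurableSet (activeCubes f) :=
    measurableSet_biUnion_of_countable measurableSet_unitCube hcount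
  have hsum : ∑' a : activeIndices f, powIntegral f (unitCube a) = powMeasure f (activeCubes f) := by
    rw [activeCubes, measure_biUnion hcount (fun a _ b _ hab => pairwise_disjoint_unitCube hab)
      fun a _ => measurableSet_unitCube a]
    exact tsum_congr fun a => hpow (measurableSet_unitCube a)
  have hgood : f ∈ goodSet p ↔ powMeasure f (activeCubes f)ᶜ = 0 := by
    rw [goodSet, Set.mem_ofPred_eq, hsum, hpow hmeas, hpow MeasurableSet.univ,
      ← measure_add_measure_compl hmeas]
    simp only [and_true]
    constructor
    · intro h
      exact (ENNReal.add_right_inj (measure_ne_top _ _)).1 (h.trans (add_zero _).symm)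
    · intro h
      rw [h, add_zero]
  rw [hgood, SetLike.mem_coe, mem_carriedBy]
  constructor
  · rintro ⟨S, hS, h⟩
    rw [restr_eq_zero_iff hp _
      (measurableSet_biUnion_of_countable measurableSet_unitCube hS).compl] at h
    -- outside the active cubes, only the null cubes indexed by `S` remain
    have hnull : powMeasure f (⋃ a ∈ S \ activeIndices f, unitCube a) = 0 :=
      (measure_biUnion_null_iff (hS.mono Set.sdiff_subset)).2 fun a ha =>
        not_not.1 fun h0 => ha.2 ((hact a).2 h0)
    refine measure_mono_null ?_ (measure_union_null h hnull)
    intro x hx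
    by_cases hxS : x ∈ ⋃ a ∈ S, unitCube a
    · obtain ⟨a, ha, hxa⟩ := Set.mem_iUnion₂.1 hxS
      exact Or.inr (Set.mem_iUnion₂.2 ⟨a, ⟨ha, fun h => hx (Set.mem_iUnion₂.2 ⟨a, h, hxa⟩)⟩, hxa⟩)
    · exact Or.inl hxS
  · intro h
    exact ⟨activeIndices f, hcount, (restr_eq_zero_iff hp f hmeas.compl).2 h⟩

end

theorem nonempty_equiv_int_sequences {ι : Type*} (hι : #ι = 𝔠) : Nonempty (ι ≃ (ℕ → ℤ)) := by
  refine Cardinal.lift_mk_eq'.1 ?_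
  rw [hι]
  simp

theorem mainTheorem6 (p : ℝ≥0∞) [Fact (1 ≤ p)] (hp : p ≠ ∞) :
    ∃ G B : Submodule ℝ (Lp ℝ p lebesgueInf),
      (G : Set (Lp ℝ p lebesgueInf)) = goodSet p ∧
      (B : Set (Lp ℝ p lebesgueInf)) = badSet p ∧
      IsClosed (G : Set (Lp ℝ p lebesgueInf)) ∧
      IsClosed (B : Set (Lp ℝ p lebesgueInf)) ∧
      Submodule.IsTopCompl G B ∧
      (∃ Φ : WithLp p (G × B) ≃ₗᵢ[ℝ] Lp ℝ p lebesgueInf,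
        ∀ (g : G) (b : B), Φ (WithLp.toLp p (g, b)) =
          (g : Lp ℝ p lebesgueInf) + (b : Lp ℝ p lebesgueInf)) ∧
      ∀ ι : Type*, #ι = 𝔠 →
        Nonempty (Lp ℝ p lebesgueInf ≃ₗᵢ[ℝ]
          WithLp p (lp (fun _ : ι => LpUnitInterval p) p × B)) := by
  obtain ⟨Φ, hΦ⟩ := Lp.exists_withLp_prod_linearIsometryEquiv (μ := lebesgueInf) hp
    measurableSet_unitCube pairwise_disjoint_unitCube
  have hcompl := Lp.isTopCompl_of_withLp_prod Φ hΦ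
  refine ⟨_, _, coe_carriedBy_unitCube hp, coe_nullOn_unitCube hp, hcompl.isClosed,
    hcompl.isClosed', hcompl, ⟨Φ, hΦ⟩, fun ι hι => ?_⟩
  obtain ⟨σ⟩ := nonempty_equiv_int_sequences hι
  obtain ⟨T⟩ := Lp.nonempty_carriedBy_linearIsometryEquiv_lp hp measurableSet_unitCube
    pairwise_disjoint_unitCube hcompl.isClosed
    (fun a => (nonempty_lp_unitCube_linearIsometryEquiv p a).some) σ
  exact ⟨Φ.symm.trans (LinearIsometryEquiv.withLpProdCongr p T (.refl ℝ _))⟩
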